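/- Let $E$ be a real Banach space with (norm) dual $E^*$ and duality pairing $\langle x,x^*\rangle = x^*(x)$. Let $S\colon E\rightrightarrows E^*$ be a multifunction, i.e. a map assigning to each $x\in E$ a subset $S(x)\subset E^*$; write $G(S)=\{(x,x^*)\in E\times E^*: x^*\in S(x)\}$ for its graph and $D(S)=\{x\in E: S(x)\neq\emptyset\}$ for its domain. Suppose that * $S$ is closed, i.e. $G(S)$ is a norm-closed subset of $E\times E^*$; * $S$ is monotone, i.e. $\langle s-t,s^*-t^*\rangle\ge 0$ for all $(s,s^*),(t,t^*)\in G(S)$; * $S$ is quasidense, i.e. for all $(x,x^*)\in E\times E^*$, $$\inf_{(s,s^*)\in G(S)}\Big[\tfrac12\|s-x\|^2+\tfrac12\|s^*-x^*\|^2+\langle s-x,s^*-x^*\rangle\Big]\le 0$$ (with $\inf\emptyset=+\infty$, so that $G(S)\ne\emptyset$). Then $S$ is maximally monotone (no monotone multifunction $E\rightrightarrows E^*$ has a graph properly containing $G(S)$) and of type (FPV): whenever $U$ is an open convex subset of $E$ with $U\cap D(S)\ne\emptyset$, and $(w,w^*)\in U\times E^*$ is such that $$(s,s^*)\in G(S)\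 \text{ and }\ s\in U\ \Longrightarrow\ \langle s-w,s^*-w^*\rangle\ge 0,$$ then $(w,w^*)\in G(S)$. -/

import Mathlib

/-- A multifunction `E ⇉ E*` from a real normed space into its (norm) dual. -/
abbrev Multifunction (E : Type*) [NormedAddCommGroup E] [NormedSpace ℝ E] : Type _ :=
  E → Set (StrongDual ℝ E)

namespace Multifunction

variable {E : Type*} [NormedAddCommGroup E] [NormedSpace ℝ E]

/-- The graph `G(S)`. -/
def graph (S : Multifunction E) : Set (E × StrongDual ℝ E) :=
  {p | p.2 ∈ S p.1}

/-- The domain `D(S)`. -/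
def domain (S : Multifunction E) : Set E :=
  {x | (S x).Nonempty}

/-- `S` is closed: its graph is closed for the norm topology of `E × E*`. -/
def Closed (S : Multifunction E) : Prop :=
  IsClosed S.graph

/-- `S` is monotone: `⟨s - t, s* - t*⟩ ≥ 0` for all `(s, s*)`, `(t, t*)` in `G(S)`. -/
def IsMonotone (S : Multifunction E) : Prop :=
  ∀ p ∈ S.graph, ∀ q ∈ S.graph, 0 ≤ (p.2 - q.2) (p.1 - q.1)

/-- `S` is maximally monotone: it is monotone, and a monotone multifunction whose graph
contains `G(S)` is equal to `S`. -/
def IsMaximallyMonotone (S : Multifunction E) : Prop :=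
  S.IsMonotone ∧ ∀ T : Multifunction E, T.IsMonotone → S.graph ⊆ T.graph → T = S

/-- `S` is quasidense. The infimum is taken in the extended reals, so that the infimum over
an empty graph is `+∞`. -/
def Quasidense (S : Multifunction E) : Prop :=
  ∀ (x : E) (x' : StrongDual ℝ E),
    (⨅ p ∈ S.graph,
      ((1 / 2 * ‖p.1 - x‖ ^ 2 + 1 / 2 * ‖p.2 - x'‖ ^ 2 + (p.2 - x') (p.1 - x) : ℝ) : EReal)) ≤ 0

/-- `S` is of type (FPV), or maximally monotone locally. -/
def IsTypeFPV (S : Multifunction E) : Prop :=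
  S.IsMonotone ∧
    ∀ U : Set E, IsOpen U → Convex ℝ U → (U ∩ S.domain).Nonempty →
      ∀ w ∈ U, ∀ w' : StrongDual ℝ E,
        (∀ p ∈ S.graph, p.1 ∈ U → 0 ≤ (p.2 - w') (p.1 - w)) → (w, w') ∈ S.graph

end Multifunction

/-!
Let `φ` be the Fitzpatrick function of `S` and `g` a convex function on a bounded open convex set
`C` meeting the domain of `S`. If `φ(x, x*) + g(x) + g*(-x*)` were bounded below by some `ε > 0`,
where the conjugate is taken over `C`, then an affine function would separate `φ` from
`ε - g(x) - g*(-x*)`; its slope, a point of `E* × E**`, would contradict the negative infimum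
property of quasidense multifunctions. Since quasidensity also gives `⟨x, x*⟩ ≤ φ(x, x*)`, a point
where the sum is small is almost a point of the graph of `S`, and at the same time `x` almost
minimizes `g + x*` on `C`.

For type (FPV), let `C` be a neighbourhood of the segment from `w` to a point of `U ∩ D(S)` that
stays well inside `U`, and let `g(x) = ‖x - w‖² / 2 - ⟨x, w*⟩`. Almost minimality, tested on a
small ball around `w`, together with the sign condition on the graph over `U`, forces the graph
point to be close to `(w, w*)`; closedness concludes.
-/

open Metric Set Bornology

section Separation

theorem isOpen_strict_hypograph {X : Type*} [TopologicalSpace X] {s : Set X} {h : X → ℝ}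
    (hs : IsOpen s) (hcont : ContinuousOn h s) :
    IsOpen {p : X × ℝ | p.1 ∈ s ∧ p.2 < h p.1} := by
  have hsub : ContinuousOn (fun p : X × ℝ => h p.1 - p.2) (Prod.fst ⁻¹' s) :=
    (hcont.comp continuousOn_fst fun _ hp => hp).sub continuousOn_snd
  simpa only [inter_def, mem_preimage, mem_Ioi, sub_pos] using
    hsub.isOpen_inter_preimage (hs.preimage continuous_fst) (isOpen_Ioi (a := (0 : ℝ)))

variable {V : Type*} [AddCommGroup V] [Module ℝ V] [TopologicalSpace V]
  [IsTopologicalAddGroup V] [ContinuousSMul ℝ V]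

theorem hahn_banach_sandwich {s : Set V} {h : V → ℝ} {φ : V → EReal} (hs : IsOpen s)
    (hconc : ConcaveOn ℝ s h) (hcont : ContinuousOn h s)
    (hφ : Convex ℝ {p : V × ℝ | φ p.1 ≤ p.2}) (hle : ∀ v ∈ s, (h v : EReal) ≤ φ v)
    (hfin : ∃ v ∈ s, φ v ≠ ⊤) :
    ∃ (L : StrongDual ℝ V) (r : ℝ), (∀ v ∈ s, h v ≤ L v + r) ∧
      ∀ v, ((L v + r : ℝ) : EReal) ≤ φ v := by
  have hdisj : Disjoint {p : V × ℝ | p.1 ∈ s ∧ p.2 < h p.1} {p : V × ℝ | φ p.1 ≤ p.2} :=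
    Set.disjoint_left.2 fun p hp hφp =>
      hp.2.not_ge (EReal.coe_le_coe_iff.1 ((hle p.1 hp.1).trans hφp))
  obtain ⟨F, u, hlt, hge⟩ :=
    geometric_hahn_banach_open hconc.convex_strict_hypograph (isOpen_strict_hypograph hs hcont)
      hφ hdisj
  set d : ℝ := F (0, 1) with hd
  have hF (v : V) (t : ℝ) : F (v, t) = F (v, 0) + t * d := by
    rw [hd, ← smul_eq_mul, ← map_smul, ← map_add]
    simp
  have hd_pos : 0 < d := by
    obtain ⟨v, hv, hvfin⟩ := hfin
    have hbelow := hlt (v, h v - 1) ⟨hv, sub_one_lt _⟩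
    obtain ⟨t, ht⟩ : ∃ t : ℝ, φ v ≤ t := ⟨_, EReal.le_coe_toReal hvfin⟩
    have habove := hge (v, t) ht
    have hht : h v ≤ t := EReal.coe_le_coe_iff.1 ((hle v hv).trans ht)
    rw [hF] at hbelow habove
    by_contra! hd_nonpos
    nlinarith
  let L : StrongDual ℝ V := -(d⁻¹ • F.comp (ContinuousLinearMap.inl ℝ V ℝ))
  have hL (v : V) : L v + u / d = (u - F (v, 0)) / d := by
    simp only [L, neg_apply, smul_apply, ContinuousLinearMap.comp_apply,
      ContinuousLinearMap.inl_apply, smul_eq_mul]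
    ring
  refine ⟨L, u / d, fun v hv => le_of_forall_lt fun t ht => ?_,
    fun v => EReal.le_of_forall_lt_iff_le.1 fun t ht => EReal.coe_le_coe_iff.2 ?_⟩
  · have hFlt := hlt (v, t) ⟨hv, ht⟩
    rw [hF] at hFlt
    rw [hL, lt_div_iff₀ hd_pos]
    linarith
  · have hFge := hge (v, t) ht.le
    rw [hF] at hFge
    rw [hL, div_le_iff₀ hd_pos]
    linarith

end Separation

section NormedSpace

variable {F : Type*} [NormedAddCommGroup F] [NormedSpace ℝ F]

theorem mul_norm_le_of_forall_norm_le {f : StrongDual ℝ F} {ρ k : ℝ} (hρ : 0 ≤ ρ)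
    (h : ∀ b, ‖b‖ ≤ ρ → f b - 1 / 2 * ‖b‖ ^ 2 ≤ k) : ρ * ‖f‖ ≤ k + 1 / 2 * ρ ^ 2 := by
  rcases hρ.eq_or_lt with rfl | hρ
  · simpa using h 0 (by simp)
  have hf : ∀ b, ‖b‖ ≤ ρ → f b ≤ k + 1 / 2 * ρ ^ 2 := fun b hb => by
    have hsq : ‖b‖ ^ 2 ≤ ρ ^ 2 := by gcongr
    linarith [h b hb]
  rw [mul_comm, ← le_div_iff₀ hρ]
  refine f.opNorm_bound_of_ball_bound hρ _ fun b hb => ?_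
  rw [mem_closedBall_zero_iff] at hb
  exact abs_le'.2 ⟨hf b hb, by simpa using hf (-b) (by rwa [norm_neg])⟩

theorem exists_half_sq_norm_sub_lt (f : StrongDual ℝ F) {ε : ℝ} (hε : 0 < ε) :
    ∃ b, 1 / 2 * ‖f‖ ^ 2 - ε < f b - 1 / 2 * ‖b‖ ^ 2 := by
  by_contra! h
  linarith [mul_norm_le_of_forall_norm_le (norm_nonneg f) fun b _ => h b]

theorem neg_half_sq_norm_add_le_apply (f : StrongDual ℝ F) (x : F) :
    -(1 / 2 * ‖f‖ ^ 2 + 1 / 2 * ‖x‖ ^ 2) ≤ f x := by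
  have hfx := (abs_le.1 (f.le_opNorm x)).1
  nlinarith [sq_nonneg (‖f‖ - ‖x‖)]

theorem norm_le_and_norm_le_of_approxMin {x p : F} {y q : StrongDual ℝ F} {ρ : ℝ} (hρ : 0 < ρ)
    (hp : ‖p‖ ≤ ρ / 2) (hq : ‖q‖ ≤ ρ / 2) (hpair : 0 ≤ (y + q) (x + p))
    (hmin : ∀ b, ‖b‖ ≤ ρ →
      1 / 2 * ‖x‖ ^ 2 + y x ≤ 1 / 2 * ‖b‖ ^ 2 + y b + (ρ / 2) ^ 2) :
    ‖x‖ ≤ 3 * ρ ∧ ‖y‖ ≤ 3 * ρ := by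
  have hconj : ρ * ‖y‖ ≤ (ρ / 2) ^ 2 - 1 / 2 * ‖x‖ ^ 2 - y x + 1 / 2 * ρ ^ 2 := by
    rw [← norm_neg y]
    refine mul_norm_le_of_forall_norm_le hρ.le fun b hb => ?_
    rw [neg_apply]
    linarith [hmin b hb]
  have hyx : -y x ≤ ρ / 2 * ‖y‖ + ρ / 2 * (‖x‖ + ρ / 2) := by
    have hyp : y p ≤ ‖y‖ * (ρ / 2) := (le_abs_self _).trans (y.le_opNorm_of_le hp)
    have hqxp : q (x + p) ≤ ρ / 2 * (‖x‖ + ρ / 2) :=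
      (le_abs_self _).trans (q.le_of_opNorm_le_of_le hq ((norm_add_le x p).trans (by gcongr)))
    rw [add_apply, map_add y] at hpair
    linarith
  have hsum : 1 / 4 * ‖x‖ ^ 2 + ρ / 2 * ‖y‖ ≤ 5 / 4 * ρ ^ 2 := by
    nlinarith [sq_nonneg (‖x‖ - ρ)]
  constructor
  · nlinarith [mul_nonneg hρ.le (norm_nonneg y)]
  · nlinarith [sq_nonneg ‖x‖]

end NormedSpace

section Conjugate

variable {F : Type*} [SeminormedAddCommGroup F] [NormedSpace ℝ F]

/-- The Fenchel conjugate of the function that equals `g` on `C` and `+∞` off `C`. It is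
real-valued, with junk value `0` if the supremum is infinite or `C` is empty. -/
noncomputable def conjugateOn (C : Set F) (g : F → ℝ) (y : StrongDual ℝ F) : ℝ :=
  ⨆ c : C, (y c - g c)

variable {C : Set F} {g : F → ℝ}

theorem conjugateOn_le (hC : C.Nonempty) {y : StrongDual ℝ F} {k : ℝ}
    (h : ∀ c ∈ C, y c - g c ≤ k) : conjugateOn C g y ≤ k :=
  have := hC.to_subtype
  ciSup_le fun c => h c c.2

theorem apply_sub_le_conjugateOn (hC : IsBounded C) (hg : BddBelow (g '' C))
    (y : StrongDual ℝ F) {c : F} (hc : c ∈ C) : y c - g c ≤ conjugateOn C g y := by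
  obtain ⟨M, hM⟩ := (y.lipschitz.isBounded_image hC).bddAbove
  obtain ⟨m, hm⟩ := hg
  have hbdd : BddAbove (range fun c : C => y c - g c) := by
    refine ⟨M - m, ?_⟩
    rintro _ ⟨c, rfl⟩
    exact sub_le_sub (hM (mem_image_of_mem y c.2)) (hm (mem_image_of_mem g c.2))
  exact le_ciSup hbdd ⟨c, hc⟩

theorem convexOn_conjugateOn (hCne : C.Nonempty) (hC : IsBounded C) (hg : BddBelow (g '' C)) :
    ConvexOn ℝ univ (conjugateOn C g) := by
  refine ⟨convex_univ, fun y _ z _ a b ha hb hab => conjugateOn_le hCne fun c hc => ?_⟩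
  calc (a • y + b • z) c - g c = a • (y c - g c) + b • (z c - g c) := by
        simp only [add_apply, smul_apply, smul_eq_mul]
        linear_combination g c * hab
    _ ≤ a • conjugateOn C g y + b • conjugateOn C g z := by
        gcongr <;> exact apply_sub_le_conjugateOn hC hg _ hc

theorem continuous_conjugateOn (hCne : C.Nonempty) (hC : IsBounded C) (hg : BddBelow (g '' C)) :
    Continuous (conjugateOn C g) := by
  obtain ⟨M, hM⟩ := hC.exists_norm_le
  refine (LipschitzWith.of_le_add_mul' M fun y z => conjugateOn_le hCne fun c hc => ?_).continuous
  have hyz : (y - z) c ≤ ‖y - z‖ * M := (le_abs_self _).trans ((y - z).le_opNorm_of_le (hM c hc))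
  rw [sub_apply] at hyz
  rw [dist_eq_norm]
  linarith [apply_sub_le_conjugateOn hC hg z hc]

end Conjugate

namespace Multifunction

variable {E : Type*} [NormedAddCommGroup E] [NormedSpace ℝ E] {S : Multifunction E}

/-- The Fitzpatrick function of `S`, a convex function on `E × E*` with values in `(-∞, +∞]`
when the graph of `S` is nonempty. -/
noncomputable def fitzpatrick (S : Multifunction E) (v : E × StrongDual ℝ E) : EReal :=
  ⨆ p ∈ S.graph, ((p.2 v.1 + v.2 p.1 - p.2 p.1 : ℝ) : EReal)

/-- `S` is of type (NI), for "negative infimum": the pairing `⟨s* - z*, s - z**⟩` over the graph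
of `S` has nonpositive infimum for every `(z*, z**)` in `E* × E**`. -/
def IsTypeNI (S : Multifunction E) : Prop :=
  ∀ (z : StrongDual ℝ E) (Z : StrongDual ℝ (StrongDual ℝ E)), ∀ ε > 0, ∃ p ∈ S.graph,
    (NormedSpace.inclusionInDoubleDual ℝ E p.1 - Z) (p.2 - z) < ε

theorem fitzpatrick_le_coe_iff {v : E × StrongDual ℝ E} {t : ℝ} :
    S.fitzpatrick v ≤ t ↔ ∀ p ∈ S.graph, p.2 v.1 + v.2 p.1 - p.2 p.1 ≤ t := by
  simp only [fitzpatrick, iSup_le_iff, EReal.coe_le_coe_iff]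

theorem convex_epigraph_fitzpatrick (S : Multifunction E) :
    Convex ℝ {q : (E × StrongDual ℝ E) × ℝ | S.fitzpatrick q.1 ≤ q.2} := by
  simp only [fitzpatrick_le_coe_iff, ofPred_forall]
  refine convex_iInter₂ fun p _ v hv w hw a b ha hb hab => ?_
  calc p.2 (a • v.1.1 + b • w.1.1) + (a • v.1.2 + b • w.1.2) p.1 - p.2 p.1
      = a • (p.2 v.1.1 + v.1.2 p.1 - p.2 p.1) + b • (p.2 w.1.1 + w.1.2 p.1 - p.2 p.1) := by
        simp only [map_add, map_smul, add_apply, smul_apply, smul_eq_mul]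
        linear_combination p.2 p.1 * hab
    _ ≤ a • v.2 + b • w.2 := by gcongr <;> assumption

theorem IsMonotone.fitzpatrick_le (hmono : S.IsMonotone) {p : E × StrongDual ℝ E}
    (hp : p ∈ S.graph) : S.fitzpatrick p ≤ ((p.2 p.1 : ℝ) : EReal) := by
  refine fitzpatrick_le_coe_iff.2 fun q hq => ?_
  have hpq := hmono p hp q hq
  simp only [sub_apply, map_sub] at hpq
  linarith

theorem Quasidense.exists_lt (hqd : S.Quasidense) (x : E) (x' : StrongDual ℝ E) {ε : ℝ}
    (hε : 0 < ε) : ∃ p ∈ S.graph,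
      1 / 2 * ‖p.1 - x‖ ^ 2 + 1 / 2 * ‖p.2 - x'‖ ^ 2 + (p.2 - x') (p.1 - x) < ε := by
  have hlt := (hqd x x').trans_lt (EReal.coe_pos.2 hε)
  simpa only [iInf_lt_iff, exists_prop, EReal.coe_lt_coe_iff] using hlt

theorem IsTypeNI.le_neg_apply_of_le_fitzpatrick (hNI : S.IsTypeNI) (hmono : S.IsMonotone)
    {z : StrongDual ℝ E} {Z : StrongDual ℝ (StrongDual ℝ E)} {r : ℝ}
    (h : ∀ v, ((z v.1 + Z v.2 + r : ℝ) : EReal) ≤ S.fitzpatrick v) : r ≤ -Z z := by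
  refine le_of_forall_pos_lt_add fun ε hε => ?_
  obtain ⟨p, hp, hlt⟩ := hNI z Z ε hε
  have hzZ := EReal.coe_le_coe_iff.1 ((h p).trans (hmono.fitzpatrick_le hp))
  simp only [sub_apply, map_sub, NormedSpace.dual_def] at hlt
  linarith

theorem Quasidense.isTypeNI (hqd : S.Quasidense) : S.IsTypeNI := by
  intro z Z ε hε
  obtain ⟨u, hu⟩ := exists_half_sq_norm_sub_lt Z (half_pos hε)
  obtain ⟨p, hp, hlt⟩ := hqd.exists_lt 0 (z + u) (half_pos hε)
  refine ⟨p, hp, ?_⟩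
  set v := p.2 - (z + u) with hv
  have hsplit : (NormedSpace.inclusionInDoubleDual ℝ E p.1 - Z) (p.2 - z) =
      v p.1 + u p.1 - Z v - Z u := by
    rw [show p.2 - z = v + u by rw [hv]; abel]
    simp only [sub_apply, map_add, NormedSpace.dual_def]
    ring
  have hup := neg_half_sq_norm_add_le_apply (-u) p.1
  have hZv := neg_half_sq_norm_add_le_apply Z v
  rw [neg_apply, norm_neg] at hup
  rw [sub_zero] at hlt
  linarith

theorem Quasidense.apply_le_fitzpatrick (hqd : S.Quasidense) (v : E × StrongDual ℝ E) :
    ((v.2 v.1 : ℝ) : EReal) ≤ S.fitzpatrick v := by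
  refine EReal.le_of_forall_lt_iff_le.1 fun t ht => ?_
  refine EReal.coe_le_coe_iff.2 (le_of_forall_pos_lt_add fun ε hε => ?_)
  obtain ⟨p, hp, hlt⟩ := hqd.exists_lt v.1 v.2 hε
  have hpt := fitzpatrick_le_coe_iff.1 ht.le p hp
  simp only [map_sub, sub_apply] at hlt
  linarith [sq_nonneg ‖p.1 - v.1‖, sq_nonneg ‖p.2 - v.2‖]

theorem Quasidense.exists_norm_sub_le (hqd : S.Quasidense) {v : E × StrongDual ℝ E} {δ : ℝ}
    (hδ : 0 < δ) (hv : S.fitzpatrick v ≤ ((v.2 v.1 + δ ^ 2 / 4 : ℝ) : EReal)) :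
    ∃ p ∈ S.graph, ‖p.1 - v.1‖ ≤ δ ∧ ‖p.2 - v.2‖ ≤ δ := by
  obtain ⟨p, hp, hlt⟩ := hqd.exists_lt v.1 v.2 (ε := δ ^ 2 / 4) (by positivity)
  have hpv := fitzpatrick_le_coe_iff.1 hv p hp
  have hsum : ‖p.1 - v.1‖ ^ 2 + ‖p.2 - v.2‖ ^ 2 ≤ δ ^ 2 := by
    simp only [map_sub, sub_apply] at hlt
    linarith
  exact ⟨p, hp, le_of_sq_le_sq (by linarith [sq_nonneg ‖p.2 - v.2‖]) hδ.le,
    le_of_sq_le_sq (by linarith [sq_nonneg ‖p.1 - v.1‖]) hδ.le⟩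

section Perturbation

variable {C : Set E} {g : E → ℝ}

theorem IsTypeNI.exists_fitzpatrick_lt (hNI : S.IsTypeNI) (hmono : S.IsMonotone)
    (hCo : IsOpen C) (hCb : IsBounded C) (hg : ConvexOn ℝ C g) (hgc : ContinuousOn g C)
    (hgb : BddBelow (g '' C)) (hdom : (C ∩ S.domain).Nonempty) {ε : ℝ} (hε : 0 < ε) :
    ∃ x ∈ C, ∃ y : StrongDual ℝ E,
      S.fitzpatrick (x, y) < ((ε - g x - conjugateOn C g (-y) : ℝ) : EReal) := by
  by_contra! hle
  obtain ⟨a, haC, a', ha⟩ := hdom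
  have hCne : C.Nonempty := ⟨a, haC⟩
  have hconc : ConcaveOn ℝ (Prod.fst ⁻¹' C) fun v : E × StrongDual ℝ E =>
      ε - g v.1 - conjugateOn C g (-v.2) := by
    have hgfst := hg.comp_linearMap (LinearMap.fst ℝ E (StrongDual ℝ E))
    have hconj := (convexOn_conjugateOn hCne hCb hgb).comp_linearMap
      (-LinearMap.snd ℝ E (StrongDual ℝ E))
    exact ((concaveOn_const ε hgfst.1).sub hgfst).sub (hconj.subset (subset_univ _) hgfst.1)
  have hcont : ContinuousOn (fun v : E × StrongDual ℝ E =>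
      ε - g v.1 - conjugateOn C g (-v.2)) (Prod.fst ⁻¹' C) := by
    have hconj := continuous_conjugateOn hCne hCb hgb
    have hgfst : ContinuousOn (fun v : E × StrongDual ℝ E => g v.1) (Prod.fst ⁻¹' C) :=
      hgc.comp continuousOn_fst (mapsTo_preimage _ C)
    exact (continuousOn_const.sub hgfst).sub (by fun_prop)
  obtain ⟨L, r, hL, hLφ⟩ := hahn_banach_sandwich (hCo.preimage continuous_fst) hconc hcont
    S.convex_epigraph_fitzpatrick (fun v hv => hle v.1 hv v.2)
    ⟨(a, a'), haC, ((hmono.fitzpatrick_le ha).trans_lt (EReal.coe_lt_top _)).ne⟩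
  set z : StrongDual ℝ E := L.comp (ContinuousLinearMap.inl ℝ E (StrongDual ℝ E)) with hz
  set Z : StrongDual ℝ (StrongDual ℝ E) :=
    L.comp (ContinuousLinearMap.inr ℝ E (StrongDual ℝ E)) with hZ
  have hLzZ (x : E) (y : StrongDual ℝ E) : L (x, y) = z x + Z y := by
    simp [hz, hZ, ← map_add]
  have hr : r ≤ -Z z := hNI.le_neg_apply_of_le_fitzpatrick hmono fun v => by
    rw [← hLzZ]
    exact hLφ v
  have hconj : conjugateOn C g (-z) ≤ conjugateOn C g (-z) - ε := by
    refine conjugateOn_le hCne fun c hc => ?_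
    have hLc := hL (c, z) hc
    rw [hLzZ] at hLc
    rw [neg_apply]
    linarith
  linarith

theorem Quasidense.exists_near_approxMin (hqd : S.Quasidense) (hmono : S.IsMonotone)
    (hCo : IsOpen C) (hCb : IsBounded C) (hg : ConvexOn ℝ C g) (hgc : ContinuousOn g C)
    (hgb : BddBelow (g '' C)) (hdom : (C ∩ S.domain).Nonempty) {δ : ℝ} (hδ : 0 < δ) :
    ∃ p ∈ S.graph, ∃ x ∈ C, ∃ y : StrongDual ℝ E, ‖p.1 - x‖ ≤ δ ∧ ‖p.2 - y‖ ≤ δ ∧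
      ∀ c ∈ C, g x + y x ≤ g c + y c + δ ^ 2 := by
  obtain ⟨x, hx, y, hlt⟩ := hqd.isTypeNI.exists_fitzpatrick_lt hmono hCo hCb hg hgc hgb hdom
    (ε := δ ^ 2 / 4) (by positivity)
  have hconj (c : E) (hc : c ∈ C) := apply_sub_le_conjugateOn hCb hgb (-y) hc
  simp only [neg_apply] at hconj
  obtain ⟨p, hp, hpx, hpy⟩ := hqd.exists_norm_sub_le hδ
    (hlt.le.trans (EReal.coe_le_coe_iff.2 (by linarith [hconj x hx])))
  have hyx := EReal.coe_lt_coe_iff.1 ((hqd.apply_le_fitzpatrick (x, y)).trans_lt hlt)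
  exact ⟨p, hp, x, hx, y, hpx, hpy, fun c hc => by linarith [hconj c hc, sq_nonneg δ]⟩

theorem Quasidense.exists_near_of_monotonicallyRelated (hqd : S.Quasidense) (hmono : S.IsMonotone)
    (hCo : IsOpen C) (hCc : Convex ℝ C) (hCb : IsBounded C) (hdom : (C ∩ S.domain).Nonempty)
    {w : E} {w' : StrongDual ℝ E} {ρ : ℝ} (hρ : 0 < ρ) (hball : closedBall w ρ ⊆ C)
    (hnonneg : ∀ p ∈ S.graph, p.1 ∈ thickening ρ C → 0 ≤ (p.2 - w') (p.1 - w)) :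
    ∃ p ∈ S.graph, ‖p.1 - w‖ ≤ 4 * ρ ∧ ‖p.2 - w'‖ ≤ 4 * ρ := by
  -- Tilting by `w'` makes approximate minimality for `g + y` a statement about `y - w'`.
  let g : E → ℝ := fun x => 1 / 2 * ‖x - w‖ ^ 2 - w' x
  have hg : ConvexOn ℝ C g := by
    have hsq : ConvexOn ℝ C fun x => 1 / 2 * ‖x - w‖ ^ 2 := by
      simpa only [dist_eq_norm, smul_eq_mul] using!
        ((convexOn_dist w hCc).pow (fun _ _ => dist_nonneg) 2).smul (by norm_num : (0 : ℝ) ≤ 1 / 2)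
    exact hsq.sub (w'.toLinearMap.concaveOn hCc)
  have hgb : BddBelow (g '' C) := by
    obtain ⟨M, hM⟩ := (w'.lipschitz.isBounded_image hCb).bddAbove
    refine ⟨-M, ?_⟩
    rintro _ ⟨c, hc, rfl⟩
    simp only [g]
    linarith [hM (mem_image_of_mem w' hc), sq_nonneg ‖c - w‖]
  obtain ⟨p, hp, x, hx, y, hpx, hpy, hmin⟩ := hqd.exists_near_approxMin hmono hCo hCb hg
    (by fun_prop) hgb hdom (half_pos hρ)
  have hpC : p.1 ∈ thickening ρ C :=
    mem_thickening_iff.2 ⟨x, hx, by rw [dist_eq_norm]; linarith⟩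
  obtain ⟨hxw, hyw⟩ := norm_le_and_norm_le_of_approxMin (x := x - w) (y := y - w') hρ hpx hpy
    (by simpa using hnonneg p hp hpC) fun b hb => by
      have hwb := hmin (w + b) (hball (by simpa [dist_eq_norm] using hb))
      simp only [g, add_sub_cancel_left, map_add] at hwb
      simp only [sub_apply, map_sub]
      linarith
  exact ⟨p, hp, by linarith [norm_sub_le_norm_sub_add_norm_sub p.1 x w],
    by linarith [norm_sub_le_norm_sub_add_norm_sub p.2 y w']⟩

end Perturbation

theorem Quasidense.isTypeFPV (hqd : S.Quasidense) (hclosed : S.Closed) (hmono : S.IsMonotone) :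
    S.IsTypeFPV := by
  refine ⟨hmono, ?_⟩
  rintro U hUo hUc ⟨a, haU, haS⟩ w hwU w' hnonneg
  have hcomp : IsCompact (segment ℝ w a) := by
    rw [segment_eq_image_lineMap]
    exact isCompact_Icc.image (by fun_prop)
  obtain ⟨R, hR, hRU⟩ := hcomp.exists_thickening_subset_open hUo (hUc.segment_subset hwU haU)
  rw [← hclosed.closure_eq, Metric.mem_closure_iff]
  intro η hη
  obtain ⟨ρ, hρ, hρR, hρη⟩ : ∃ ρ > 0, ρ < R / 2 ∧ ρ < η / 4 :=
    (exists_between (lt_min (half_pos hR) (by positivity : 0 < η / 4))).imp fun ρ h =>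
      ⟨h.1, lt_min_iff.1 h.2⟩
  have hball : closedBall w ρ ⊆ thickening (R / 2) (segment ℝ w a) :=
    (closedBall_subset_ball hρR).trans (ball_subset_thickening (left_mem_segment ℝ w a) _)
  have hthick : thickening ρ (thickening (R / 2) (segment ℝ w a)) ⊆ U :=
    (thickening_thickening_subset _ _ _).trans ((thickening_mono (by linarith) _).trans hRU)
  obtain ⟨p, hp, hpw, hpw'⟩ := hqd.exists_near_of_monotonicallyRelated hmono isOpen_thickening
    ((convex_segment w a).thickening _) hcomp.isBounded.thickening
    ⟨a, self_subset_thickening (half_pos hR) _ (right_mem_segment ℝ w a), haS⟩ hρ hball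
    fun p hp hpC => hnonneg p hp (hthick hpC)
  refine ⟨p, hp, ?_⟩
  rw [dist_comm, dist_eq_norm, Prod.norm_def]
  exact max_lt (by simpa using hpw.trans_lt (by linarith))
    (by simpa using hpw'.trans_lt (by linarith))

theorem IsTypeFPV.isMaximallyMonotone (h : S.IsTypeFPV) (hne : S.domain.Nonempty) :
    S.IsMaximallyMonotone := by
  refine ⟨h.1, fun T hT hST => ?_⟩
  ext x x'
  refine ⟨fun hx => ?_, fun hx => hST (a := (x, x')) hx⟩
  exact h.2 univ isOpen_univ convex_univ (by simpa using hne) x (mem_univ x) x'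
    fun p hp _ => hT p (hST hp) (x, x') hx

theorem Quasidense.domain_nonempty (hqd : S.Quasidense) : S.domain.Nonempty :=
  let ⟨p, hp, _⟩ := hqd.exists_lt 0 0 one_pos
  ⟨p.1, p.2, hp⟩

end Multifunction

theorem mainTheorem2_general {E : Type*} [NormedAddCommGroup E] [NormedSpace ℝ E]
    (S : Multifunction E) (hclosed : S.Closed) (hmono : S.IsMonotone) (hqd : S.Quasidense) :
    S.IsMaximallyMonotone ∧ S.IsTypeFPV :=
  have hFPV := hqd.isTypeFPV hclosed hmono
  ⟨hFPV.isMaximallyMonotone hqd.domain_nonempty, hFPV⟩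

theorem mainTheorem2 {E : Type*} [NormedAddCommGroup E] [NormedSpace ℝ E] [CompleteSpace E]
    (S : Multifunction E) (hclosed : S.Closed) (hmono : S.IsMonotone) (hqd : S.Quasidense) :
    S.IsMaximallyMonotone ∧ S.IsTypeFPV :=
  mainTheorem2_general S hclosed hmono hqd
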